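/- Let $n$ be a positive odd integer and let $q$ be a prime power with $\gcd(q,n)=1$ such that $q$ is a quadratic residue modulo $n$. Then there exist an integer $d$ and a quantum duadic code of length $n$ over $\mathbb{F}_q$ with parameters $[[n,1,d]]_q$ and $d^2\ge n$. If, in addition, the multiplicative order $\operatorname{ord}_n(q)$ of $q$ modulo $n$ is odd, then there also exist an integer $d$ and a quantum duadic code of length $n$ over $\mathbb{F}_q$ with parameters $[[n,1,d]]_q$ and $d^2-d+1\ge n$. Here the terms have the following meaning. *Duadic codes.* A splitting of $n$ is a triple $(S_0,S_1,a)$ such that $S_0,S_1$ are disjoint unions of $q$-ary cyclotomic cosets modulo $n$ with $S_0\cup S_1=\{1,\dots,n-1\}$, and $a$ is coprime to $n$ with $aS_0\equiv S_1$ and $aS_1\equiv S_0$ modulo $n$. Let $\alpha$ be a primitive $n$-th root of unity in an algebraic closure of $\mathbb{F}_q$. The odd-like duadic code $D_i\subseteq\mathbb{F}_q^n$ $(i\in\{0,1\})$ is the cyclic code with defining set $S_i$, that is, the set of all $(c_0,\dots,c_{n-1})$ with $\sum_{l} c_l\alpha^{jl}=0$ for all $j\in S_i$ (equivalently, the cyclic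 code with generator polynomial $\prod_{j\in S_i}(x-\alpha^j)$). The even-like duadic code $C_i$ is the set of all $c\in D_i$ with $\sum_l c_l=0$. *Quantum codes.* Let $p$ be the characteristic of $\mathbb{F}_q$, let $\omega=e^{2\pi i/p}$, and let $\operatorname{tr}$ be the trace from $\mathbb{F}_q$ to $\mathbb{F}_p$. Let $\mathbb{C}^{q^n}$ have the orthonormal basis $|x\rangle$, $x\in\mathbb{F}_q^n$. For $a,b\in\mathbb{F}_q^n$ put $X(a)|x\rangle=|x+a\rangle$ and $Z(b)|x\rangle=\omega^{\operatorname{tr}(b\cdot x)}|x\rangle$. The error group consists of the operators $\omega^cX(a)Z(b)$ with $c\in\mathbb{F}_p$; the weight of such an operator is the number of $k$ with $(a_k,b_k)\ne(0,0)$. A stabilizer code is a nonzero subspace $Q\subseteq\mathbb{C}^{q^n}$ that is the joint $+1$ eigenspace of the group of all error-group elements fixing every vector of $Q$. The code $Q$ detects an operator $E$ if there is a scalar $\lambda_E$ with $\langle u|E|v\rangle=\lambda_E\langle u|v\rangle$ for all $u,v\in Q$. An $[[n,k,d]]_q$ code is a stabilizer code of dimension $q^k$ with minimum distance $d$, that is,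 it detects all errors of weight less than $d$ in the error group, but fails to detect some error of weight $d$. *Quantum duadic codes.* The CSS construction assigns to linear codes $C\subseteq D\subseteq\mathbb{F}_q^n$ the joint $+1$ eigenspace of all operators $X(a)Z(b)$ with $a\in D^\perp$ and $b\in C$, where $\perp$ is the Euclidean dual. A quantum duadic code of length $n$ over $\mathbb{F}_q$ is the code that the CSS construction assigns to $C_i\subseteq D_i$, for the duadic codes $C_i$, $D_i$ of some splitting of $n$, some $\alpha$ and some $i\in\{0,1\}$. -/

import Mathlib

open Polynomial

noncomputable section

namespace QDuadic

/-! ### Classical codes of length `n` over a finite field `F` -/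

section Classical

variable {F : Type*} [Field F] {n : ℕ}

/-- The Euclidean dual `C^⊥ = {x | x · c = 0 for all c ∈ C}`. -/
def dualCode (C : Submodule F (Fin n → F)) : Submodule F (Fin n → F) where
  carrier := {x | ∀ c ∈ C, x ⬝ᵥ c = 0}
  add_mem' := fun hx hy c hc => by rw [add_dotProduct, hx c hc, hy c hc, add_zero]
  zero_mem' := fun c _ => zero_dotProduct c
  smul_mem' := fun r x hx c hc => by rw [smul_dotProduct, hx c hc, smul_zero]

/-- The polynomial `c(x) = ∑ cᵢ xⁱ` of a word `c = (c₀, …, c_{n-1})`. -/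
def wordPoly (c : Fin n → F) : F[X] := ∑ i : Fin n, C (c i) * X ^ (i : ℕ)

/-- The cyclic code of length `n` with defining set `T ⊆ ℤ/n` relative to the root of unity `α`:
all words `c` with `c(α^j) = 0` for every `j ∈ T`. -/
def cyclicCode (α : AlgebraicClosure F) (T : Set (ZMod n)) : Submodule F (Fin n → F) where
  carrier := {c | ∀ j ∈ T, aeval (α ^ j.val) (wordPoly c) = 0}
  add_mem' := fun {x y} hx hy j hj => by
    have h : wordPoly (x + y) = wordPoly x + wordPoly y := by
      simp [wordPoly, add_mul, Finset.sum_add_distrib]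
    rw [h, map_add, hx j hj, hy j hj, add_zero]
  zero_mem' := fun j _ => by simp [wordPoly]
  smul_mem' := fun r x hx j hj => by
    have h : wordPoly (r • x) = C r * wordPoly x := by
      simp [wordPoly, Finset.mul_sum, mul_assoc]
    rw [h, map_mul, hx j hj, mul_zero]

/-- For a primitive `n`-th root of unity `α`, the code with defining set `T` is the code
generated by `∏_{j ∈ T} (x - α^j)`. -/
theorem mem_cyclicCode_iff_dvd [NeZero n] {α : AlgebraicClosure F} (hα : IsPrimitiveRoot α n)
    (T : Finset (ZMod n)) (c : Fin n → F) :
    c ∈ cyclicCode α (T : Set (ZMod n)) ↔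
      (∏ j ∈ T, (X - C (α ^ j.val))) ∣
        (wordPoly c).map (algebraMap F (AlgebraicClosure F)) := by
  have key : ∀ j : ZMod n, aeval (α ^ j.val) (wordPoly c) = 0 ↔
      (X - C (α ^ j.val)) ∣ (wordPoly c).map (algebraMap F (AlgebraicClosure F)) := by
    intro j
    rw [dvd_iff_isRoot, IsRoot.def, eval_map_algebraMap]
  have hmem : c ∈ cyclicCode α (T : Set (ZMod n)) ↔
      ∀ j ∈ T, aeval (α ^ j.val) (wordPoly c) = 0 := Iff.rfl
  rw [hmem]
  constructor
  · intro h
    refine Finset.prod_dvd_of_coprime (fun i _ j _ hij => ?_) (fun j hj => (key j).1 (h j hj))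
    refine isCoprime_X_sub_C_of_isUnit_sub (IsUnit.mk0 _ (sub_ne_zero.2 fun he => hij ?_))
    exact ZMod.val_injective n (hα.pow_inj (ZMod.val_lt i) (ZMod.val_lt j) he)
  · intro h j hj
    exact (key j).2 ((Finset.dvd_prod_of_mem (fun j : ZMod n => X - C (α ^ j.val)) hj).trans h)

/-- The even-like subcode of `D`: the words of `D` whose coordinates sum to zero. -/
def evenLikeSubcode (D : Submodule F (Fin n → F)) : Submodule F (Fin n → F) where
  carrier := {c | c ∈ D ∧ ∑ i, c i = 0}
  add_mem' := fun hx hy => ⟨D.add_mem hx.1 hy.1, by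
    simp [Finset.sum_add_distrib, hx.2, hy.2]⟩
  zero_mem' := ⟨D.zero_mem, by simp⟩
  smul_mem' := fun r x hx => ⟨D.smul_mem r hx.1, by
    simp [← Finset.mul_sum, hx.2]⟩

end Classical

/-- `(S₀, S₁, a)` is a splitting of `n` over a field with `q` elements: `S₀` and `S₁` are unions of
`q`-ary cyclotomic cosets modulo `n` that partition `{1, …, n-1}`, and multiplication by the
unit `a` modulo `n` interchanges them. -/
structure IsSplitting (q n : ℕ) (S₀ S₁ : Set (ZMod n)) (a : (ZMod n)ˣ) : Prop where
  coset₀ : ∀ j ∈ S₀, (q : ZMod n) * j ∈ S₀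
  coset₁ : ∀ j ∈ S₁, (q : ZMod n) * j ∈ S₁
  disjoint : S₀ ∩ S₁ = ∅
  union : S₀ ∪ S₁ = {j | j ≠ 0}
  image₀ : (fun j => (a : ZMod n) * j) '' S₀ = S₁
  image₁ : (fun j => (a : ZMod n) * j) '' S₁ = S₀

/-! ### Quantum codes: subspaces of `ℂ^(q^n)`, with orthonormal basis `|x⟩`, `x ∈ F^n` -/

section Quantum

variable (F : Type*) [Field F] [Fintype F] (n : ℕ)

set_option linter.unusedSectionVars false

/-- The state space of `n` qudits. -/
abbrev StateSpace := EuclideanSpace ℂ (Fin n → F)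

/-- The root of unity `ω = exp(2πi/p)`, where `p` is the characteristic of `F`. -/
def omega : ℂ := Complex.exp (2 * Real.pi * Complex.I / (ringChar F : ℂ))

/-- The absolute trace of `F` over its prime field. -/
def absTrace (x : F) : ZMod (ringChar F) :=
  letI : Algebra (ZMod (ringChar F)) F := ZMod.algebra F (ringChar F)
  Algebra.trace (ZMod (ringChar F)) F x

variable {F n}

/-- `X(a) = X(a₁) ⊗ ⋯ ⊗ X(aₙ)`, that is, `X(a)|x⟩ = |x + a⟩`. -/
def opX (a : Fin n → F) : StateSpace F n →ₗ[ℂ] StateSpace F n where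
  toFun ψ := WithLp.toLp 2 fun x => ψ (x - a)
  map_add' _ _ := by ext; simp
  map_smul' _ _ := by ext; simp

/-- `Z(b) = Z(b₁) ⊗ ⋯ ⊗ Z(bₙ)`, that is, `Z(b)|x⟩ = ω^{tr(b · x)}|x⟩`. -/
def opZ (b : Fin n → F) : StateSpace F n →ₗ[ℂ] StateSpace F n where
  toFun ψ := WithLp.toLp 2 fun x => omega F ^ (absTrace F (b ⬝ᵥ x)).val * ψ x
  map_add' _ _ := by ext; simp [mul_add]
  map_smul' _ _ := by ext; simp; ring

open Classical in
theorem opX_single (a x : Fin n → F) :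
    opX a (EuclideanSpace.single x (1 : ℂ)) = EuclideanSpace.single (x + a) 1 := by
  ext y
  simp [opX, sub_eq_iff_eq_add]

open Classical in
theorem opZ_single (b x : Fin n → F) :
    opZ b (EuclideanSpace.single x (1 : ℂ)) =
      omega F ^ (absTrace F (b ⬝ᵥ x)).val • EuclideanSpace.single x (1 : ℂ) := by
  ext y
  by_cases h : y = x <;> simp [opZ, h]

/-- The element `ω^c X(a) Z(b)` of the error group. -/
def errorOp (c : ZMod (ringChar F)) (a b : Fin n → F) : StateSpace F n →ₗ[ℂ] StateSpace F n :=
  omega F ^ c.val • (opX a ∘ₗ opZ b)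

/-- The symplectic weight of `(a|b)`, which is the weight of the error `ω^c X(a) Z(b)`. -/
def symplecticWeight (a b : Fin n → F) : ℕ := Set.ncard {k | (a k, b k) ≠ (0, 0)}

/-- The stabilizer of `Q`: all elements of the error group that fix every vector of `Q`.
If `Q ≠ 0`, two such operators commute, because their commutator is a scalar
that fixes a nonzero vector. -/
def stabilizer (Q : Submodule ℂ (StateSpace F n)) : Set (StateSpace F n →ₗ[ℂ] StateSpace F n) :=
  {E | (∃ c a b, E = errorOp c a b) ∧ ∀ ψ ∈ Q, E ψ = ψ}

/-- A stabilizer code is a nonzero subspace that contains all joint fixed vectors of its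
stabilizer. -/
def IsStabilizerCode (Q : Submodule ℂ (StateSpace F n)) : Prop :=
  Q ≠ ⊥ ∧ ∀ ψ, ψ ∈ Q ↔ ∀ E ∈ stabilizer Q, E ψ = ψ

/-- `Q` detects `E` if `⟨u|E|v⟩ = z ⟨u|v⟩` on `Q`, for a scalar `z` depending only on `E`. -/
def Detects (Q : Submodule ℂ (StateSpace F n)) (E : StateSpace F n →ₗ[ℂ] StateSpace F n) : Prop :=
  ∃ z : ℂ, ∀ u ∈ Q, ∀ v ∈ Q, inner ℂ u (E v) = z * inner ℂ u v

/-- `Q` detects all errors of weight less than `d`, and fails to detect some error of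
weight `d`. -/
def HasMinDistance (Q : Submodule ℂ (StateSpace F n)) (d : ℕ) : Prop :=
  (∀ (c : ZMod (ringChar F)) (a b : Fin n → F), symplecticWeight a b < d →
    Detects Q (errorOp c a b)) ∧
  ∃ (c : ZMod (ringChar F)) (a b : Fin n → F), symplecticWeight a b = d ∧
    ¬ Detects Q (errorOp c a b)

/-- `Q` is an `[[n, k, d]]_q` stabilizer code, where `q` is the number of elements of `F`. -/
def IsStabilizerCodeWithParams (Q : Submodule ℂ (StateSpace F n)) (k d : ℕ) : Prop :=
  IsStabilizerCode Q ∧ Module.finrank ℂ Q = Fintype.card F ^ k ∧ HasMinDistance Q d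

/-- The CSS code of `C ⊆ D`: the joint `+1` eigenspace of the operators `X(a) Z(b)` with
`(a|b) ∈ D^⊥ × C`. -/
def cssCode (C D : Submodule F (Fin n → F)) : Submodule ℂ (StateSpace F n) where
  carrier := {ψ | ∀ a ∈ dualCode D, ∀ b ∈ C, opX a (opZ b ψ) = ψ}
  add_mem' := fun hx hy a ha b hb => by rw [map_add, map_add, hx a ha b hb, hy a ha b hb]
  zero_mem' := fun a _ b _ => by rw [map_zero, map_zero]
  smul_mem' := fun r x hx a ha b hb => by rw [map_smul, map_smul, hx a ha b hb]

/-- A quantum duadic code of length `n` over `F`: the CSS code of an even-like duadic code `C₀`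
inside the odd-like duadic code `D₀`. Exchanging `S₀` and `S₁` gives the other pair
`C₁ ⊆ D₁`. -/
def IsQuantumDuadicCode (Q : Submodule ℂ (StateSpace F n)) : Prop :=
  ∃ (S₀ S₁ : Set (ZMod n)) (a : (ZMod n)ˣ) (α : AlgebraicClosure F),
    IsSplitting (Fintype.card F) n S₀ S₁ a ∧ IsPrimitiveRoot α n ∧
      Q = cssCode (evenLikeSubcode (cyclicCode α S₀)) (cyclicCode α S₀)

end Quantum

end QDuadic

end

/-!
Every splitting of `n` gives a quantum duadic code `[[n, 1, d]]_q`, and `d` is the least weight of an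
odd-like word of the duadic code `D` with defining set `S₀`. Write `C` for the even-like subcode of
`D`, and let the Fourier transform over `ℤ/n` carry a word `c` to the values `c(α^j)`.

*The quantum code.* The all-ones word lies in `D`, so `D = C ⊕ ⟨1⟩` and `C^⊥ = D^⊥ ⊕ ⟨1⟩`. The states
of the CSS code are supported on `C^⊥` and constant on cosets of `D^⊥`, hence they are the functions
of the coordinate sum on `C^⊥` (`eq_sumState_of_mem_cssCode`): the dimension is `q`. An error
`X(a)Z(b)` is detected unless `a ∈ C^⊥`, `b ∈ D` and one of `a`, `b` is odd-like, and `Z(b)` is indeed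
undetected for odd-like `b ∈ D`. A multiplier carries `C^⊥` into `D`
(`IsSplitting.exists_mem_cyclicCode_of_mem_dualCode`, which rests on
`fourier_neg_eq_zero_of_mem_dualCode`), so the odd-like words of `C^⊥` are no lighter than those of
`D`, and `isStabilizerCodeWithParams_cssCode` applies.

*The bounds.* If `c ∈ D` is odd-like, its image under the multiplier `a` is an odd-like word of the
other duadic code, and the product of the two in `F[x]/(xⁿ - 1)` has a transform supported at `0`:
it is a nonzero multiple of `1 + x + ⋯ + x^(n-1)`. So each of the `n` residues is a sum of two
elements of the supports, and `n ≤ d²`. If `a = -1`, each residue is a difference of two elements of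
one support, and the `d` diagonal pairs all give `0`; this gives `n ≤ d² - d + 1`.

*The splittings.* If `q` is a square modulo `n`, colour `j ≠ 0` by the Legendre symbol of
`j / gcd(j, n)` modulo the least prime factor of `n / gcd(j, n)`. Multiplication by `q` preserves the
colour, and multiplication by a simultaneous nonresidue modulo all primes dividing `n` reverses it. If
`ord_n(q)` is odd, no nonzero cyclotomic coset equals its negative, and comparing the least
elements of the cosets of `j` and `-j` gives a splitting with multiplier `-1`.
-/

noncomputable section

namespace QDuadic

/-! ### Splittings of `ℤ/n` -/

section Splitting

variable {q n : ℕ}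

/-- A two-colouring of the nonzero residues that is constant on cyclotomic cosets and reversed by
the unit `a` defines a splitting; here `u` is `q` as a unit. -/
theorem isSplitting_of_coloring {κ : ZMod n → ℤ} {u a : (ZMod n)ˣ} (hu : (u : ZMod n) = q)
    (h1 : ∀ j, j ≠ 0 → κ j = 1 ∨ κ j = -1) (hκu : ∀ j, j ≠ 0 → κ (u * j) = κ j)
    (hκa : ∀ j, j ≠ 0 → κ (a * j) = -κ j) :
    IsSplitting q n {j | j ≠ 0 ∧ κ j = 1} {j | j ≠ 0 ∧ κ j = -1} a where
  coset₀ := fun j hj => ⟨by rw [← hu]; simpa using hj.1, by rw [← hu, hκu j hj.1, hj.2]⟩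
  coset₁ := fun j hj => ⟨by rw [← hu]; simpa using hj.1, by rw [← hu, hκu j hj.1, hj.2]⟩
  disjoint := by
    ext j
    simp only [Set.mem_inter_iff, Set.mem_ofPred_eq, Set.mem_empty_iff_false, iff_false]
    rintro ⟨⟨-, h⟩, -, h'⟩
    omega
  union := by
    ext j
    simp only [Set.mem_union, Set.mem_ofPred_eq, ← and_or_left, and_iff_left_iff_imp]
    exact h1 j
  image₀ := by
    ext j
    constructor
    · rintro ⟨i, ⟨hi, hi'⟩, rfl⟩
      exact ⟨by simpa using hi, by simp only [hκa i hi, hi']⟩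
    · rintro ⟨hj, hj'⟩
      have h0 : (↑a⁻¹ : ZMod n) * j ≠ 0 := by simpa using hj
      have h2 := hκa _ h0
      rw [Units.mul_inv_cancel_left] at h2
      exact ⟨_, ⟨h0, by omega⟩, Units.mul_inv_cancel_left a j⟩
  image₁ := by
    ext j
    constructor
    · rintro ⟨i, ⟨hi, hi'⟩, rfl⟩
      exact ⟨by simpa using hi, by simp only [hκa i hi, hi', neg_neg]⟩
    · rintro ⟨hj, hj'⟩
      have h0 : (↑a⁻¹ : ZMod n) * j ≠ 0 := by simpa using hj
      have h2 := hκa _ h0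
      rw [Units.mul_inv_cancel_left] at h2
      exact ⟨_, ⟨h0, by omega⟩, Units.mul_inv_cancel_left a j⟩

/-- The least prime factor of the additive order `n / gcd(j, n)` of `j` in `ℤ/n`. -/
def orderMinFac (j : ZMod n) : ℕ := (n / j.val.gcd n).minFac

/-- The Legendre symbol of `j / gcd(j, n)` modulo the prime `orderMinFac j`. -/
def reducedSymbol (j : ZMod n) : ℤ := jacobiSym ((j.val / j.val.gcd n : ℕ) : ℤ) (orderMinFac j)

theorem gcd_val_unit_mul [NeZero n] (u : (ZMod n)ˣ) (j : ZMod n) :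
    ((u : ZMod n) * j).val.gcd n = j.val.gcd n := by
  rw [ZMod.val_mul, ← Nat.gcd_rec, Nat.gcd_comm,
    Nat.Coprime.gcd_mul_left_cancel _ (ZMod.val_coe_unit_coprime u)]

theorem orderMinFac_unit_mul [NeZero n] (u : (ZMod n)ˣ) (j : ZMod n) :
    orderMinFac ((u : ZMod n) * j) = orderMinFac j := by
  rw [orderMinFac, gcd_val_unit_mul, orderMinFac]

theorem orderMinFac_dvd (j : ZMod n) : orderMinFac j ∣ n :=
  (Nat.minFac_dvd _).trans (Nat.div_dvd_of_dvd (Nat.gcd_dvd_right _ _))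

theorem orderMinFac_prime [NeZero n] {j : ZMod n} (hj : j ≠ 0) : (orderMinFac j).Prime := by
  refine Nat.minFac_prime fun h => hj ?_
  have h1 : n = j.val.gcd n := by
    have := Nat.div_mul_cancel (Nat.gcd_dvd_right j.val n)
    rw [h, one_mul] at this
    exact this.symm
  have h2 : n ∣ j.val := Nat.gcd_eq_right_iff_dvd.1 h1.symm
  exact (ZMod.val_eq_zero j).1 (Nat.eq_zero_of_dvd_of_lt h2 (ZMod.val_lt j))

theorem reducedSymbol_eq_one_or_neg_one [NeZero n] (j : ZMod n) :
    reducedSymbol j = 1 ∨ reducedSymbol j = -1 := by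
  refine jacobiSym.eq_one_or_neg_one ?_
  have h : (j.val / j.val.gcd n).Coprime (n / j.val.gcd n) :=
    Nat.coprime_div_gcd_div_gcd (Nat.gcd_pos_of_pos_right _ (NeZero.pos n))
  rw [Int.gcd_natCast_natCast]
  exact h.of_dvd_right (Nat.minFac_dvd _)

theorem reducedSymbol_unit_mul [NeZero n] (u : (ZMod n)ˣ) (j : ZMod n) :
    reducedSymbol ((u : ZMod n) * j) =
      jacobiSym ((u : ZMod n).val : ℤ) (orderMinFac j) * reducedSymbol j := by
  rw [reducedSymbol, reducedSymbol, orderMinFac_unit_mul, gcd_val_unit_mul, ← jacobiSym.mul_left]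
  refine jacobiSym.mod_left' ?_
  change _ ≡ _ [ZMOD _]
  rw [← Nat.cast_mul, Int.natCast_modEq_iff]
  refine Nat.ModEq.of_dvd (Nat.minFac_dvd (n / j.val.gcd n)) ?_
  rw [ZMod.val_mul]
  have hg : 0 < j.val.gcd n := Nat.gcd_pos_of_pos_right _ (NeZero.pos n)
  generalize hgd : j.val.gcd n = g at *
  obtain ⟨x, hx⟩ : g ∣ j.val := hgd ▸ Nat.gcd_dvd_left _ _
  obtain ⟨m, hm⟩ : g ∣ n := hgd ▸ Nat.gcd_dvd_right _ _
  have e1 : n / g = m := by rw [hm, Nat.mul_div_cancel_left _ hg]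
  have e2 : (u : ZMod n).val * j.val % n = g * ((u : ZMod n).val * x % m) := by
    rw [← Nat.mul_mod_mul_left, ← hm, hx, Nat.mul_left_comm]
  rw [e1, e2, hx, Nat.mul_div_cancel_left _ hg, Nat.mul_div_cancel_left _ hg]
  exact Nat.mod_modEq _ _

/-- There is a residue that is a quadratic nonresidue modulo every prime factor of `n` at once. -/
theorem exists_nat_jacobiSym_eq_neg_one (hn : Odd n) :
    ∃ k : ℕ, ∀ p, p.Prime → p ∣ n → jacobiSym k p = -1 := by
  have hns : ∀ p : ℕ, ∃ s : ℕ, p.Prime → p ∣ n → jacobiSym s p = -1 := by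
    intro p
    by_cases hp : p.Prime ∧ p ∣ n
    · have : Fact p.Prime := ⟨hp.1⟩
      have h2 : ringChar (ZMod p) ≠ 2 := by
        rw [ZMod.ringChar_zmod_n]
        rintro rfl
        exact (Nat.not_even_iff_odd.2 hn) (even_iff_two_dvd.2 hp.2)
      obtain ⟨x, hx⟩ := FiniteField.exists_nonsquare h2
      refine ⟨x.val, fun _ _ => ?_⟩
      rw [← jacobiSym.legendreSym.to_jacobiSym, legendreSym.eq_neg_one_iff]
      simpa using hx
    · exact ⟨0, fun h1 h2 => absurd ⟨h1, h2⟩ hp⟩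
  choose s hs using hns
  obtain ⟨k, hk⟩ := Nat.chineseRemainderOfFinset s id n.primeFactors
    (fun p hp => (Nat.prime_of_mem_primeFactors hp).ne_zero)
    (fun p hp r hr hpr => (Nat.coprime_primes (Nat.prime_of_mem_primeFactors hp)
      (Nat.prime_of_mem_primeFactors hr)).2 hpr)
  refine ⟨k, fun p hp hpn => ?_⟩
  have hn0 : n ≠ 0 := by rintro rfl; simp at hn
  rw [← hs p hp hpn]
  refine jacobiSym.mod_left' ?_
  exact_mod_cast hk p (Nat.mem_primeFactors.2 ⟨hp, hpn, hn0⟩)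

theorem jacobiSym_val_eq {p k : ℕ} (hpn : p ∣ n) {x : ZMod n} (hx : (k : ZMod n) = x) :
    jacobiSym (x.val : ℤ) p = jacobiSym k p := by
  refine jacobiSym.mod_left' ?_
  change _ ≡ _ [ZMOD _]
  rw [Int.natCast_modEq_iff, ← hx, ZMod.val_natCast]
  exact (Nat.mod_modEq k n).of_dvd hpn

/-- If `q` is a square modulo `n`, then the reduced Legendre symbol is constant on cyclotomic
cosets, and a simultaneous nonresidue reverses it. -/
theorem exists_isSplitting (hn : Odd n) (hcop : Nat.Coprime q n) (hsq : IsSquare (q : ZMod n)) :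
    ∃ S₀ S₁ a, IsSplitting q n S₀ S₁ a := by
  have : NeZero n := ⟨by rintro rfl; simp at hn⟩
  obtain ⟨k, hk⟩ := exists_nat_jacobiSym_eq_neg_one hn
  have hkn : k.Coprime n := by
    refine Nat.coprime_of_dvd fun p hp hpk hpn => ?_
    have h1 := hk p hp hpn
    have : Fact p.Prime := ⟨hp⟩
    rw [← jacobiSym.legendreSym.to_jacobiSym, legendreSym.eq_neg_one_iff] at h1
    refine h1 ?_
    rw [Int.cast_natCast, (ZMod.natCast_eq_zero_iff k p).2 hpk]
    exact IsSquare.zero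
  refine ⟨_, _, _, isSplitting_of_coloring (κ := reducedSymbol) (u := ZMod.unitOfCoprime q hcop)
    (a := ZMod.unitOfCoprime k hkn) (ZMod.coe_unitOfCoprime q hcop)
    (fun j _ => reducedSymbol_eq_one_or_neg_one j) (fun j hj => ?_) (fun j hj => ?_)⟩
  · rw [reducedSymbol_unit_mul, jacobiSym_val_eq (orderMinFac_dvd j)
      (ZMod.coe_unitOfCoprime q hcop).symm]
    have : Fact (orderMinFac j).Prime := ⟨orderMinFac_prime hj⟩
    rw [← jacobiSym.legendreSym.to_jacobiSym, (legendreSym.eq_one_iff _ ?_).2 ?_, one_mul]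
    · rw [Int.cast_natCast, Ne, ZMod.natCast_eq_zero_iff]
      intro h
      exact (orderMinFac_prime hj).one_lt.ne' (Nat.eq_one_of_dvd_coprimes hcop h
        (orderMinFac_dvd j))
    · have := hsq.map (ZMod.castHom (orderMinFac_dvd j) (ZMod (orderMinFac j)))
      simpa using this
  · rw [reducedSymbol_unit_mul, jacobiSym_val_eq (orderMinFac_dvd j)
      (ZMod.coe_unitOfCoprime k hkn).symm, hk _ (orderMinFac_prime hj) (orderMinFac_dvd j),
      neg_one_mul]

/-- The least representative in `{0, …, n-1}` of the orbit of `j` under multiplication by the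
powers of `u`. -/
def orbitMin (u : (ZMod n)ˣ) (j : ZMod n) : ℕ :=
  sInf (Set.range fun i : ℤ => (((u ^ i : (ZMod n)ˣ) : ZMod n) * j).val)

theorem orbitMin_unit_mul (u : (ZMod n)ˣ) (j : ZMod n) : orbitMin u (u * j) = orbitMin u j := by
  rw [orbitMin, orbitMin]
  congr 1
  rw [← (Equiv.addRight (1 : ℤ)).surjective.range_comp
    fun i : ℤ => (((u ^ i : (ZMod n)ˣ) : ZMod n) * j).val]
  congr 1
  ext i
  simp [zpow_add_one, mul_assoc]

theorem exists_of_orbitMin_eq [NeZero n] {u : (ZMod n)ˣ} {j k : ZMod n}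
    (h : orbitMin u j = orbitMin u k) :
    ∃ i : ℤ, ((u ^ i : (ZMod n)ˣ) : ZMod n) * j = k := by
  obtain ⟨i, hi⟩ := Nat.sInf_mem
    (Set.range_nonempty fun i : ℤ => (((u ^ i : (ZMod n)ˣ) : ZMod n) * j).val)
  obtain ⟨l, hl⟩ := Nat.sInf_mem
    (Set.range_nonempty fun i : ℤ => (((u ^ i : (ZMod n)ˣ) : ZMod n) * k).val)
  have he : ((u ^ i : (ZMod n)ˣ) : ZMod n) * j = ((u ^ l : (ZMod n)ˣ) : ZMod n) * k :=
    ZMod.val_injective n (hi.trans (h.trans hl.symm))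
  refine ⟨-l + i, ?_⟩
  rw [zpow_add, Units.val_mul, mul_assoc, he, zpow_neg, Units.inv_mul_cancel_left]

/-- If the order of `q` is odd, then no nonzero cyclotomic coset is closed under negation: from
`q^i j = -j` and `N = ord(q)` odd follows `j = q^(iN) j = (-1)^N j = -j`. -/
theorem orbitMin_neg_ne (hn : Odd n) {u : (ZMod n)ˣ} (hu : Odd (orderOf u)) {j : ZMod n}
    (hj : j ≠ 0) : orbitMin u (-j) ≠ orbitMin u j := by
  have : NeZero n := ⟨by rintro rfl; simp at hn⟩
  intro h
  obtain ⟨i, hi⟩ := exists_of_orbitMin_eq h.symm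
  have hpow : ∀ m : ℕ, ((u ^ i : (ZMod n)ˣ) : ZMod n) ^ m * j = (-1) ^ m * j := by
    intro m
    induction m with
    | zero => simp
    | succ m ih => rw [pow_succ, mul_assoc, hi, mul_neg, ih]; ring
  have h1 := hpow (orderOf u)
  rw [← Units.val_pow_eq_pow_val, ← zpow_natCast, zpow_comm, zpow_natCast, pow_orderOf_eq_one,
    one_zpow, hu.neg_one_pow, Units.val_one, one_mul, neg_one_mul] at h1
  refine hj ?_
  have h2 : IsUnit (2 : ZMod n) := by
    simpa using (ZMod.isUnit_iff_coprime 2 n).2 (Nat.coprime_two_left.2 hn)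
  refine (h2.mul_right_eq_zero).1 ?_
  linear_combination h1

theorem exists_isSplitting_neg_one (hn : Odd n) (hcop : Nat.Coprime q n)
    (hord : Odd (orderOf (q : ZMod n))) : ∃ S₀ S₁, IsSplitting q n S₀ S₁ (-1) := by
  have hu := ZMod.coe_unitOfCoprime q hcop
  set u := ZMod.unitOfCoprime q hcop
  rw [← hu, orderOf_units] at hord
  refine ⟨_, _, isSplitting_of_coloring (u := u)
    (κ := fun j => if orbitMin u j < orbitMin u (-j) then 1 else -1)
    hu (fun j _ => by grind) (fun j _ => ?_) (fun j hj => ?_)⟩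
  · simp only [← mul_neg, orbitMin_unit_mul]
  · have := orbitMin_neg_ne hn hord hj
    simp only [Units.val_neg, Units.val_one, neg_one_mul, neg_neg]
    grind

end Splitting

/-! ### The discrete Fourier transform over a field with a primitive `n`-th root of unity -/

section Fourier

variable {K : Type*} [Field K] {n : ℕ} [NeZero n] {χ : AddChar (ZMod n) K}

/-- The Fourier transform (Mattson–Solomon polynomial) of a word indexed by `ℤ/n`: its value at
`j` is the value of the word's polynomial at `χ j = α^j`. -/
def fourier (χ : AddChar (ZMod n) K) (f : ZMod n → K) (j : ZMod n) : K := ∑ l, f l * χ (j * l)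

theorem fourier_zero_right (f : ZMod n → K) : fourier χ f 0 = ∑ l, f l := by
  simp [fourier]

theorem sum_fourier_mul (hχ : χ.IsPrimitive) (f : ZMod n → K) (k : ZMod n) :
    ∑ j, fourier χ f j * χ (-(j * k)) = n * f k := by
  simp only [fourier, Finset.sum_mul]
  rw [Finset.sum_comm]
  have h : ∀ l, ∑ j, f l * χ (j * l) * χ (-(j * k)) = if l = k then n * f k else 0 := by
    intro l
    have h1 : ∀ j : ZMod n, f l * χ (j * l) * χ (-(j * k)) = f l * χ (j * (l - k)) := by
      intro j
      rw [mul_assoc, ← AddChar.map_add_eq_mul]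
      congr 2
      ring
    simp only [h1, ← Finset.mul_sum, AddChar.sum_mulShift _ hχ, sub_eq_zero, ZMod.card]
    split_ifs with hl
    · rw [hl, mul_comm]
    · simp
  simp [h]

theorem eq_zero_of_fourier_eq_zero (hχ : χ.IsPrimitive) (hn : (n : K) ≠ 0) {f : ZMod n → K}
    (h : ∀ j, fourier χ f j = 0) (k : ZMod n) : f k = 0 := by
  have := sum_fourier_mul hχ f k
  simpa [h, hn] using this.symm

/-- A word whose transform is supported at `0` is constant. -/
theorem natCast_mul_eq_sum_of_fourier_eq_zero (hχ : χ.IsPrimitive) {f : ZMod n → K}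
    (h : ∀ j, j ≠ 0 → fourier χ f j = 0) (k : ZMod n) : n * f k = ∑ l, f l := by
  rw [← sum_fourier_mul hχ f k, Finset.sum_eq_single 0, fourier_zero_right]
  · simp
  · intro j _ hj
    rw [h j hj, zero_mul]
  · simp

/-- The cyclic convolution, which is the product in `K[x]/(xⁿ - 1)`. -/
def cyclicConv (f g : ZMod n → K) (k : ZMod n) : K := ∑ l, f l * g (k - l)

theorem fourier_cyclicConv (f g : ZMod n → K) (j : ZMod n) :
    fourier χ (cyclicConv f g) j = fourier χ f j * fourier χ g j := by
  simp only [fourier, cyclicConv, Finset.sum_mul]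
  rw [Finset.sum_comm]
  refine Finset.sum_congr rfl fun l _ => ?_
  rw [Finset.mul_sum, ← Equiv.sum_comp (Equiv.addRight l)]
  refine Finset.sum_congr rfl fun m _ => ?_
  simp only [Equiv.coe_addRight, add_sub_cancel_right]
  rw [mul_add, AddChar.map_add_eq_mul]
  ring

theorem fourier_comp_unit_mul (u : (ZMod n)ˣ) (f : ZMod n → K) (j : ZMod n) :
    fourier χ (fun l => f (u * l)) j = fourier χ f (↑u⁻¹ * j) := by
  simp only [fourier]
  rw [← Equiv.sum_comp (Units.mulLeft u⁻¹)]
  refine Finset.sum_congr rfl fun l _ => ?_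
  simp only [Units.mulLeft_apply, Units.mul_inv_cancel_left]
  congr 2
  ring

/-- If two words have nonzero coordinate sum and transforms of disjoint support apart from `0`, then
their product in `K[x]/(xⁿ - 1)` is a nonzero multiple of `1 + x + ⋯ + x^(n-1)`, so every residue
is a sum of elements of the two supports. -/
theorem exists_add_eq_of_fourier_mul_eq_zero (hχ : χ.IsPrimitive) {f g : ZMod n → K}
    (h : ∀ j, j ≠ 0 → fourier χ f j * fourier χ g j = 0) (hf : ∑ l, f l ≠ 0) (hg : ∑ l, g l ≠ 0)
    (k : ZMod n) : ∃ l m, f l ≠ 0 ∧ g m ≠ 0 ∧ l + m = k := by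
  have h1 := natCast_mul_eq_sum_of_fourier_eq_zero hχ (f := cyclicConv f g)
    (fun j hj => by rw [fourier_cyclicConv, h j hj]) k
  rw [← fourier_zero_right (χ := χ), fourier_cyclicConv, fourier_zero_right,
    fourier_zero_right] at h1
  have h2 : cyclicConv f g k ≠ 0 := fun h0 => by
    rw [h0, mul_zero] at h1
    exact mul_ne_zero hf hg h1.symm
  obtain ⟨l, -, hl⟩ := Finset.exists_ne_zero_of_sum_ne_zero h2
  exact ⟨l, k - l, left_ne_zero_of_mul hl, right_ne_zero_of_mul hl, add_sub_cancel l k⟩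

end Fourier

/-! ### Cyclic codes through the Fourier transform -/

section CyclicCode

variable {F : Type*} [Field F] {n : ℕ} [NeZero n]

/-- A word over `F`, regarded as a function on `ℤ/n` with values in the algebraic closure. -/
def extend (c : Fin n → F) (l : ZMod n) : AlgebraicClosure F :=
  algebraMap F _ (c ((ZMod.finEquiv n).symm l))

/-- The additive character `l ↦ α^l` of `ℤ/n`. -/
def rootChar {α : AlgebraicClosure F} (hα : IsPrimitiveRoot α n) :
    AddChar (ZMod n) (AlgebraicClosure F) :=
  AddChar.zmodChar n hα.pow_eq_one

theorem rootChar_isPrimitive {α : AlgebraicClosure F} (hα : IsPrimitiveRoot α n) :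
    (rootChar hα).IsPrimitive :=
  AddChar.zmodChar_primitive_of_primitive_root n hα

theorem finEquiv_eq_natCast (i : Fin n) : ZMod.finEquiv n i = ((i : ℕ) : ZMod n) := by
  obtain _ | n := n
  · exact i.elim0
  · exact (Fin.cast_val_eq_self i).symm

theorem aeval_wordPoly {α : AlgebraicClosure F} (hα : IsPrimitiveRoot α n) (c : Fin n → F)
    (j : ZMod n) : aeval (α ^ j.val) (wordPoly c) = fourier (rootChar hα) (extend c) j := by
  rw [fourier, ← (ZMod.finEquiv n).toEquiv.sum_comp]
  simp only [wordPoly, map_sum, map_mul, aeval_C, map_pow, aeval_X, extend]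
  refine Finset.sum_congr rfl fun i _ => ?_
  simp only [RingEquiv.toEquiv_eq_coe, EquivLike.coe_coe, RingEquiv.symm_apply_apply]
  congr 1
  rw [← pow_mul, rootChar, finEquiv_eq_natCast,
    ← AddChar.zmodChar_apply' hα.pow_eq_one]
  simp

theorem mem_cyclicCode_iff {α : AlgebraicClosure F} (hα : IsPrimitiveRoot α n) {T : Set (ZMod n)}
    {c : Fin n → F} :
    c ∈ cyclicCode α T ↔ ∀ j ∈ T, fourier (rootChar hα) (extend c) j = 0 := by
  simp only [← aeval_wordPoly hα]
  rfl

theorem sum_extend (c : Fin n → F) : ∑ l, extend c l = algebraMap F _ (∑ i, c i) := by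
  rw [map_sum, ← (ZMod.finEquiv n).toEquiv.sum_comp]
  simp [extend]

theorem sum_extend_ne_zero {c : Fin n → F} (hc : ∑ i, c i ≠ 0) : ∑ l, extend c l ≠ 0 := by
  rw [sum_extend]
  exact (_root_.map_ne_zero _).2 hc

/-- Coordinates permuted by the multiplier `l ↦ u l`. -/
def multiplier (u : (ZMod n)ˣ) : Fin n ≃ Fin n :=
  (ZMod.finEquiv n).toEquiv.trans ((Units.mulLeft u).trans (ZMod.finEquiv n).toEquiv.symm)

theorem extend_comp_multiplier (u : (ZMod n)ˣ) (c : Fin n → F) :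
    extend (c ∘ multiplier u) = fun l => extend c (u * l) := by
  ext l
  simp [extend, multiplier]

/-- The all-ones word has transform supported at `0`, so it lies in every odd-like code. -/
theorem one_mem_cyclicCode {α : AlgebraicClosure F} (hα : IsPrimitiveRoot α n)
    {T : Set (ZMod n)} (hT : (0 : ZMod n) ∉ T) : (1 : Fin n → F) ∈ cyclicCode α T := by
  rw [mem_cyclicCode_iff hα]
  intro j hj
  have h := AddChar.sum_mulShift j (rootChar_isPrimitive hα)
  have hj0 : j ≠ 0 := fun h0 => hT (h0 ▸ hj)
  rw [if_neg hj0, Nat.cast_zero] at h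
  simpa [fourier, extend, mul_comm] using h

theorem mem_range_algebraMap_of_pow_card_eq [Fintype F] {y : AlgebraicClosure F}
    (hy : y ^ Fintype.card F = y) : ∃ x : F, algebraMap F _ x = y := by
  have h0 : (X ^ Fintype.card F - X : F[X]) ≠ 0 :=
    FiniteField.X_pow_card_sub_X_ne_zero F Fintype.one_lt_card
  have hs : (X ^ Fintype.card F - X : F[X]).Splits := by
    rw [splits_iff_card_roots, FiniteField.roots_X_pow_card_sub_X,
      FiniteField.X_pow_card_sub_X_natDegree_eq F Fintype.one_lt_card]
    rfl
  exact hs.mem_range_of_isRoot (i := algebraMap F (AlgebraicClosure F)) h0 (x := y) (by simp [hy])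

/-- The dual of an even-like code. The word with transform `n χ(jk)` at `j ∈ S₁` and `0` elsewhere is
fixed by Frobenius because `S₁` is a union of cyclotomic cosets; so it belongs to the even-like code
of `S₀`. Orthogonality to all these words makes the transform of `x` vanish on `-S₁`. -/
theorem fourier_neg_eq_zero_of_mem_dualCode [Fintype F] {α : AlgebraicClosure F}
    (hα : IsPrimitiveRoot α n) (hn : (n : AlgebraicClosure F) ≠ 0)
    (hcop : Nat.Coprime (Fintype.card F) n) {S₀ S₁ : Set (ZMod n)}
    (hS₁ : ∀ j ∈ S₁, (Fintype.card F : ZMod n) * j ∈ S₁) (hd : S₀ ∩ S₁ = ∅)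
    (h0 : (0 : ZMod n) ∉ S₁) {x : Fin n → F}
    (hx : x ∈ dualCode (evenLikeSubcode (cyclicCode α S₀))) {i : ZMod n} (hi : i ∈ S₁) :
    fourier (rootChar hα) (extend x) (-i) = 0 := by
  classical
  set χ := rootChar hα with hχdef
  have hχ := rootChar_isPrimitive hα
  -- `e k` is the word with transform `n χ(jk)` on `S₁`, by Fourier inversion.
  set e : ZMod n → ZMod n → AlgebraicClosure F :=
    fun k l => ∑ i, if i ∈ S₁ then χ (i * (k - l)) else 0 with he
  set u := ZMod.unitOfCoprime _ hcop with hu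
  have hmem : ∀ j, (u : ZMod n) * j ∈ S₁ ↔ j ∈ S₁ := by
    have hsub : Set.MapsTo (fun j => (u : ZMod n) * j) S₁ S₁ := fun j hj => by
      simpa [hu] using hS₁ j hj
    have hinj : Function.Injective (fun j => (u : ZMod n) * j) := (Units.mulLeft u).injective
    have hbij := (S₁.toFinite.injOn_iff_bijOn_of_mapsTo hsub).1 hinj.injOn
    refine fun j => ⟨fun hj => ?_, fun hj => hsub hj⟩
    obtain ⟨j', hj', hjj⟩ := hbij.surjOn hj
    exact hinj hjj ▸ hj'
  have hfrob : ∀ k l, e k l ^ Fintype.card F = e k l := by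
    intro k l
    have h1 : ∀ z : AlgebraicClosure F, z ^ Fintype.card F =
      FiniteField.frobeniusAlgHom F (AlgebraicClosure F) z := fun z => rfl
    rw [h1]
    simp only [he, map_sum]
    conv_rhs => rw [← Equiv.sum_comp (Units.mulLeft u)]
    refine Finset.sum_congr rfl fun i _ => ?_
    simp only [Units.mulLeft_apply, hmem]
    split_ifs
    · rw [← h1, ← AddChar.map_nsmul_eq_pow, nsmul_eq_mul, hu, ZMod.coe_unitOfCoprime, mul_assoc]
    · rw [map_zero]
  choose w hw using fun k l => mem_range_algebraMap_of_pow_card_eq (hfrob k l)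
  have hext : ∀ k, extend (fun i => w k (ZMod.finEquiv n i)) = e k := by
    intro k
    ext l
    simp [extend, hw]
  have hfour : ∀ k j, j ∉ S₁ →
      fourier χ (extend fun i => w k (ZMod.finEquiv n i)) j = 0 := by
    intro k j hj
    rw [hext]
    simp only [fourier, he, Finset.sum_mul]
    rw [Finset.sum_comm]
    refine Finset.sum_eq_zero fun i _ => ?_
    split_ifs with hiS
    · have hij : j - i ≠ 0 := by
        rw [sub_ne_zero]
        rintro rfl
        exact hj hiS
      have h2 := AddChar.sum_mulShift (j - i) hχ
      rw [if_neg hij, Nat.cast_zero] at h2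
      have h3 : ∀ l, χ (i * (k - l)) * χ (j * l) = χ (i * k) * χ (l * (j - i)) := by
        intro l
        rw [← AddChar.map_add_eq_mul, ← AddChar.map_add_eq_mul]
        congr 1
        ring
      simp only [h3, ← Finset.mul_sum]
      rw [hχdef, h2, mul_zero]
    · simp
  have hword : ∀ k, (fun i => w k (ZMod.finEquiv n i)) ∈
      evenLikeSubcode (cyclicCode α S₀) := by
    intro k
    refine ⟨(mem_cyclicCode_iff hα).2 fun j hj => hfour k j fun hj' => ?_, ?_⟩
    · exact (Set.eq_empty_iff_forall_notMem.1 hd) j ⟨hj, hj'⟩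
    · have h2 := hfour k 0 h0
      rw [fourier_zero_right, sum_extend] at h2
      exact (map_eq_zero _).1 h2
  -- As a function of `k`, the product of `x` with `e k` is itself a Fourier transform.
  have hg : ∀ k, fourier χ (fun i => if i ∈ S₁ then fourier χ (extend x) (-i) else 0) k = 0 := by
    intro k
    have h2 : ∑ l, extend x l * e k l = 0 := by
      have h3 := congrArg (algebraMap F (AlgebraicClosure F)) (hx _ (hword k))
      rw [map_zero, dotProduct, map_sum] at h3
      rw [← h3, ← Equiv.sum_comp (ZMod.finEquiv n).toEquiv]
      refine Finset.sum_congr rfl fun i _ => ?_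
      simp [extend, hw]
    refine Eq.trans ?_ h2
    simp only [fourier, he, Finset.mul_sum]
    rw [Finset.sum_comm]
    refine Finset.sum_congr rfl fun i _ => ?_
    split_ifs
    · rw [Finset.sum_mul]
      refine Finset.sum_congr rfl fun l _ => ?_
      rw [mul_assoc, ← AddChar.map_add_eq_mul]
      congr 2
      ring
    · simp
  have := eq_zero_of_fourier_eq_zero hχ hn hg i
  simpa [hi] using this

end CyclicCode

/-! ### The CSS code of an odd-like code and its even-like subcode -/

section Dual

variable {F : Type*} [Field F] {n : ℕ} {D : Submodule F (Fin n → F)}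

theorem mem_dualCode_iff {C : Submodule F (Fin n → F)} {x : Fin n → F} :
    x ∈ dualCode C ↔ ∀ c ∈ C, x ⬝ᵥ c = 0 := Iff.rfl

theorem dualCode_le_dualCode_evenLikeSubcode : dualCode D ≤ dualCode (evenLikeSubcode D) :=
  fun _ hx c hc => hx c hc.1

theorem const_mem_dualCode_evenLikeSubcode (t : F) :
    (fun _ => t) ∈ dualCode (evenLikeSubcode D) := by
  intro c hc
  simp [dotProduct, ← Finset.mul_sum, hc.2]

theorem mem_dualCode_of_sum_eq_zero (hn : (n : F) ≠ 0) (hD : 1 ∈ D) {x : Fin n → F}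
    (hx : x ∈ dualCode (evenLikeSubcode D)) (hs : ∑ i, x i = 0) : x ∈ dualCode D := by
  intro c hc
  have hc' : c - ((∑ i, c i) / n) • (1 : Fin n → F) ∈ evenLikeSubcode D := by
    refine ⟨D.sub_mem hc (D.smul_mem _ hD), ?_⟩
    simp [Finset.sum_sub_distrib, mul_div_cancel₀ _ hn]
  have h := hx _ hc'
  rw [dotProduct_sub, dotProduct_smul, dotProduct_one, hs, smul_zero, sub_zero] at h
  exact h

/-- The nontrivial inclusion in `D^⊥⊥ = D`. -/
theorem exists_mem_dualCode_dotProduct_ne_zero {b : Fin n → F} (hb : b ∉ D) :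
    ∃ a ∈ dualCode D, a ⬝ᵥ b ≠ 0 := by
  obtain ⟨f, hfb, hf⟩ := Submodule.exists_le_ker_of_notMem hb
  have h : ∀ x, (fun i => f (Pi.single i 1)) ⬝ᵥ x = f x := by
    intro x
    conv_rhs => rw [pi_eq_sum_univ' x]
    simp [dotProduct, mul_comm]
  exact ⟨fun i => f (Pi.single i 1), fun c hc => (h c).trans (hf hc), by rwa [h]⟩

end Dual

section Character

variable (F : Type*) [Field F] [Fintype F]

instance neZero_ringChar : NeZero (ringChar F) := ⟨CharP.ringChar_ne_zero_of_finite F⟩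

theorem omega_isPrimitiveRoot : IsPrimitiveRoot (omega F) (ringChar F) :=
  Complex.isPrimitiveRoot_exp _ (NeZero.ne _)

/-- The additive character `x ↦ ω^(tr x)` of `F`. -/
def traceChar : AddChar F ℂ :=
  letI : Algebra (ZMod (ringChar F)) F := ZMod.algebra F (ringChar F)
  (AddChar.zmodChar (ringChar F) (omega_isPrimitiveRoot F).pow_eq_one).compAddMonoidHom
    (Algebra.trace (ZMod (ringChar F)) F).toAddMonoidHom

variable {F}

theorem traceChar_apply (x : F) : traceChar F x = omega F ^ (absTrace F x).val := rfl

theorem exists_traceChar_mul_ne_one {x : F} (hx : x ≠ 0) : ∃ t, traceChar F (x * t) ≠ 1 := by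
  let : Algebra (ZMod (ringChar F)) F := ZMod.algebra F (ringChar F)
  obtain ⟨t, ht⟩ := FiniteField.trace_to_zmod_nondegenerate F hx
  refine ⟨t, fun h => ht ?_⟩
  rw [traceChar_apply, (omega_isPrimitiveRoot F).pow_eq_one_iff_dvd] at h
  exact (ZMod.val_eq_zero _).1 (Nat.eq_zero_of_dvd_of_lt h (ZMod.val_lt _))

end Character

section CSS

variable {F : Type*} [Field F] {n : ℕ} {D : Submodule F (Fin n → F)}

theorem opX_apply (a x : Fin n → F) (ψ : StateSpace F n) : opX a ψ x = ψ (x - a) := rfl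

theorem errorOp_zero (a b : Fin n → F) : errorOp 0 a b = opX a ∘ₗ opZ b := by
  simp [errorOp]

/-- The state `∑_{x ∈ C^⊥} f(x₁ + ⋯ + xₙ) |x⟩`, where `C` is the even-like subcode of `D`. -/
def sumState (D : Submodule F (Fin n → F)) (f : F → ℂ) : StateSpace F n :=
  open Classical in
  WithLp.toLp 2 fun x => if x ∈ dualCode (evenLikeSubcode D) then f (∑ i, x i) else 0

theorem sumState_apply_of_mem (f : F → ℂ) {x : Fin n → F}
    (hx : x ∈ dualCode (evenLikeSubcode D)) : sumState D f x = f (∑ i, x i) :=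
  if_pos hx

theorem sumState_apply_of_notMem (f : F → ℂ) {x : Fin n → F}
    (hx : x ∉ dualCode (evenLikeSubcode D)) : sumState D f x = 0 :=
  if_neg hx

theorem symplecticWeight_zero_left [DecidableEq F] (b : Fin n → F) :
    symplecticWeight 0 b = hammingNorm b := by
  rw [symplecticWeight, hammingNorm, ← Set.ncard_coe_finset]
  congr 1
  ext k
  simp

theorem hammingNorm_left_le [DecidableEq F] (a b : Fin n → F) :
    hammingNorm a ≤ symplecticWeight a b := by
  rw [symplecticWeight, hammingNorm, ← Set.ncard_coe_finset]
  refine Set.ncard_le_ncard (fun k hk h => ?_) (Set.toFinite _)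
  simp only [Finset.coe_filter, Finset.mem_univ, true_and, Set.mem_ofPred_eq] at hk
  exact hk (Prod.ext_iff.1 h).1

theorem hammingNorm_right_le [DecidableEq F] (a b : Fin n → F) :
    hammingNorm b ≤ symplecticWeight a b := by
  rw [symplecticWeight, hammingNorm, ← Set.ncard_coe_finset]
  refine Set.ncard_le_ncard (fun k hk h => ?_) (Set.toFinite _)
  simp only [Finset.coe_filter, Finset.mem_univ, true_and, Set.mem_ofPred_eq] at hk
  exact hk (Prod.ext_iff.1 h).2

variable [Fintype F]

theorem opZ_apply (b x : Fin n → F) (ψ : StateSpace F n) :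
    opZ b ψ x = traceChar F (b ⬝ᵥ x) * ψ x := rfl

theorem errorOp_apply (c : ZMod (ringChar F)) (a b x : Fin n → F) (ψ : StateSpace F n) :
    errorOp c a b ψ x = omega F ^ c.val * (traceChar F (b ⬝ᵥ (x - a)) * ψ (x - a)) := rfl

theorem sumState_mem_cssCode (hD : 1 ∈ D) (f : F → ℂ) :
    sumState D f ∈ cssCode (evenLikeSubcode D) D := by
  intro a ha b hb
  ext x
  rw [opX_apply, opZ_apply]
  have ha' := dualCode_le_dualCode_evenLikeSubcode ha
  have hs : ∑ i, a i = 0 := by rw [← dotProduct_one]; exact ha 1 hD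
  by_cases hx : x ∈ dualCode (evenLikeSubcode D)
  · have hxa := Submodule.sub_mem _ hx ha'
    rw [sumState_apply_of_mem f hx, sumState_apply_of_mem f hxa, dotProduct_comm, hxa b hb,
      AddChar.map_zero_eq_one, one_mul]
    simp [Finset.sum_sub_distrib, hs]
  · rw [sumState_apply_of_notMem f hx, sumState_apply_of_notMem, mul_zero]
    rwa [Submodule.sub_mem_iff_left _ ha']

/-- `Z`-type stabilizers confine the support of a code state to `C^⊥`. -/
theorem apply_eq_zero_of_mem_cssCode {ψ : StateSpace F n}
    (hψ : ψ ∈ cssCode (evenLikeSubcode D) D) {x : Fin n → F}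
    (hx : x ∉ dualCode (evenLikeSubcode D)) : ψ x = 0 := by
  rw [mem_dualCode_iff] at hx
  push Not at hx
  obtain ⟨b, hb, hxb⟩ := hx
  obtain ⟨t, ht⟩ := exists_traceChar_mul_ne_one hxb
  have h := congrArg (fun φ : StateSpace F n => φ x)
    (hψ 0 (Submodule.zero_mem _) (t • b) (Submodule.smul_mem _ t hb))
  simp only [opX_apply, opZ_apply, sub_zero, smul_dotProduct, smul_eq_mul] at h
  rw [dotProduct_comm, mul_comm t] at h
  by_contra h0
  exact ht (mul_right_cancel₀ h0 (h.trans (one_mul _).symm))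

/-- `X`-type stabilizers make a code state constant on cosets of `D^⊥`. -/
theorem apply_sub_of_mem_cssCode {ψ : StateSpace F n}
    (hψ : ψ ∈ cssCode (evenLikeSubcode D) D) {a : Fin n → F} (ha : a ∈ dualCode D)
    (x : Fin n → F) : ψ (x - a) = ψ x := by
  have h := congrArg (fun φ : StateSpace F n => φ x) (hψ a ha 0 (Submodule.zero_mem _))
  simpa [opX_apply, opZ_apply] using h

/-- `C^⊥` is the direct sum of `D^⊥` and the constant words, and the coordinate sum parametrizes
`C^⊥ / D^⊥`. -/
theorem eq_sumState_of_mem_cssCode (hn : (n : F) ≠ 0) (hD : 1 ∈ D) {ψ : StateSpace F n}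
    (hψ : ψ ∈ cssCode (evenLikeSubcode D) D) : ψ = sumState D fun t => ψ fun _ => t / n := by
  ext x
  by_cases hx : x ∈ dualCode (evenLikeSubcode D)
  · rw [sumState_apply_of_mem _ hx]
    have ha : (x - fun _ => (∑ i, x i) / n) ∈ dualCode D := by
      refine mem_dualCode_of_sum_eq_zero hn hD
        (Submodule.sub_mem _ hx (const_mem_dualCode_evenLikeSubcode _)) ?_
      simp [Finset.sum_sub_distrib, mul_div_cancel₀ _ hn]
    rw [← apply_sub_of_mem_cssCode hψ ha x, sub_sub_cancel]
  · rw [sumState_apply_of_notMem _ hx, apply_eq_zero_of_mem_cssCode hψ hx]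

theorem finrank_cssCode (hn : (n : F) ≠ 0) (hD : 1 ∈ D) :
    Module.finrank ℂ (cssCode (evenLikeSubcode D) D) = Fintype.card F := by
  let e : (F → ℂ) ≃ₗ[ℂ] cssCode (evenLikeSubcode D) D :=
    { toFun := fun f => ⟨sumState D f, sumState_mem_cssCode hD f⟩
      map_add' := fun f g => by
        ext x
        by_cases hx : x ∈ dualCode (evenLikeSubcode D) <;> simp [sumState, hx]
      map_smul' := fun r f => by
        ext x
        by_cases hx : x ∈ dualCode (evenLikeSubcode D) <;> simp [sumState, hx]
      invFun := fun ψ t => (ψ : StateSpace F n) fun _ => t / n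
      left_inv := fun f => by
        ext t
        dsimp only
        rw [sumState_apply_of_mem f (const_mem_dualCode_evenLikeSubcode _)]
        simp [mul_div_cancel₀ _ hn]
      right_inv := fun ψ => Subtype.ext (eq_sumState_of_mem_cssCode hn hD ψ.2).symm }
  rw [← e.finrank_eq, Module.finrank_fintype_fun_eq_card]

theorem isStabilizerCode_cssCode (hn : (n : F) ≠ 0) (hD : 1 ∈ D) :
    IsStabilizerCode (cssCode (evenLikeSubcode D) D) := by
  refine ⟨fun h => ?_, fun ψ => ⟨fun hψ E hE => hE.2 ψ hψ, fun h a ha b hb => ?_⟩⟩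
  · have h1 := finrank_cssCode hn hD
    rw [h, finrank_bot] at h1
    exact Fintype.card_ne_zero h1.symm
  · refine h (opX a ∘ₗ opZ b) ⟨⟨0, a, b, (errorOp_zero a b).symm⟩, fun φ hφ => hφ a ha b hb⟩

theorem inner_errorOp (c : ZMod (ringChar F)) (a b : Fin n → F) (u v : StateSpace F n) :
    inner ℂ u (errorOp c a b v) =
      ∑ x, omega F ^ c.val * (traceChar F (b ⬝ᵥ (x - a)) * v (x - a)) * star (u x) := by
  rw [PiLp.inner_apply]
  rfl

/-- An error `X(a)Z(b)` with `a ∉ C^⊥` moves the support of every code state off `C^⊥`. -/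
theorem detects_of_notMem_dualCode (c : ZMod (ringChar F)) {a : Fin n → F} (b : Fin n → F)
    (ha : a ∉ dualCode (evenLikeSubcode D)) :
    Detects (cssCode (evenLikeSubcode D) D) (errorOp c a b) := by
  refine ⟨0, fun u hu v hv => ?_⟩
  rw [inner_errorOp, zero_mul]
  refine Finset.sum_eq_zero fun x _ => ?_
  by_cases hx : x ∈ dualCode (evenLikeSubcode D)
  · rw [apply_eq_zero_of_mem_cssCode hv, mul_zero, mul_zero, zero_mul]
    rwa [Submodule.sub_mem_iff_right _ hx]
  · rw [apply_eq_zero_of_mem_cssCode hu hx, star_zero, mul_zero]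

/-- An error `X(a)Z(b)` with `b ∉ D` commutes with some `X(a')`, `a' ∈ D^⊥`, only up to a
nontrivial phase; translating by `a'` multiplies the inner product by that phase. -/
theorem detects_of_notMem (c : ZMod (ringChar F)) (a : Fin n → F) {b : Fin n → F} (hb : b ∉ D) :
    Detects (cssCode (evenLikeSubcode D) D) (errorOp c a b) := by
  obtain ⟨a', ha', hab⟩ := exists_mem_dualCode_dotProduct_ne_zero hb
  obtain ⟨t, ht⟩ := exists_traceChar_mul_ne_one hab
  have hta := Submodule.smul_mem _ t ha'
  refine ⟨0, fun u hu v hv => ?_⟩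
  rw [zero_mul]
  have h : inner ℂ u (errorOp c a b v) =
      traceChar F (a' ⬝ᵥ b * t) * inner ℂ u (errorOp c a b v) := by
    conv_lhs => rw [inner_errorOp, ← Equiv.sum_comp (Equiv.addRight (t • a'))]
    rw [inner_errorOp, Finset.mul_sum]
    refine Finset.sum_congr rfl fun x _ => ?_
    have hu' := apply_sub_of_mem_cssCode hu hta (x + t • a')
    have hv' := apply_sub_of_mem_cssCode hv hta (x + t • a' - a)
    rw [add_sub_cancel_right] at hu'
    rw [add_sub_right_comm, add_sub_cancel_right] at hv'
    rw [Equiv.coe_addRight, ← hu', add_sub_right_comm, ← hv', dotProduct_add,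
      AddChar.map_add_eq_mul, dotProduct_smul, smul_eq_mul, dotProduct_comm b a', mul_comm t]
    ring
  by_contra h0
  exact ht (mul_right_cancel₀ h0 (h.symm.trans (one_mul _).symm))

theorem detects_of_mem (c : ZMod (ringChar F)) {a b : Fin n → F} (ha : a ∈ dualCode D)
    (hb : b ∈ evenLikeSubcode D) :
    Detects (cssCode (evenLikeSubcode D) D) (errorOp c a b) := by
  refine ⟨omega F ^ c.val, fun u _ v hv => ?_⟩
  have h : errorOp c a b v = omega F ^ c.val • v := by
    rw [errorOp, LinearMap.smul_apply, LinearMap.comp_apply, hv a ha b hb]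
  rw [h, inner_smul_right]

/-- For odd-like `b ∈ D`, the error `Z(b)` acts on the basis states of the code, indexed by `t ∈ F`,
by the phases `ω^{tr(t Σb / n)}`, which are not all equal. -/
theorem not_detects_opZ (hn : (n : F) ≠ 0) (hD : 1 ∈ D) {b : Fin n → F} (hb : b ∈ D)
    (hs : ∑ i, b i ≠ 0) :
    ¬ Detects (cssCode (evenLikeSubcode D) D) (errorOp 0 0 b) := by
  rintro ⟨z, hz⟩
  classical
  have hphase : ∀ x ∈ dualCode (evenLikeSubcode D),
      b ⬝ᵥ x = (∑ i, b i) * ((∑ i, x i) / n) := by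
    intro x hx
    have ha : (x - fun _ => (∑ i, x i) / n) ∈ dualCode D := by
      refine mem_dualCode_of_sum_eq_zero hn hD
        (Submodule.sub_mem _ hx (const_mem_dualCode_evenLikeSubcode _)) ?_
      simp [Finset.sum_sub_distrib, mul_div_cancel₀ _ hn]
    have h1 := ha b hb
    rw [sub_dotProduct, sub_eq_zero] at h1
    rw [dotProduct_comm, h1]
    rw [dotProduct, ← Finset.mul_sum, mul_comm]
  have key : ∀ s : F, z = traceChar F ((∑ i, b i) * (s / n)) := by
    intro s
    set ψ := sumState D (Pi.single s 1) with hψ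
    have hmem : ψ ∈ cssCode (evenLikeSubcode D) D := sumState_mem_cssCode hD _
    have hE : errorOp 0 0 b ψ = traceChar F ((∑ i, b i) * (s / n)) • ψ := by
      ext x
      rw [errorOp_apply, PiLp.smul_apply, smul_eq_mul, sub_zero, ZMod.val_zero, pow_zero, one_mul]
      by_cases hx : x ∈ dualCode (evenLikeSubcode D)
      · rw [hphase x hx, hψ, sumState_apply_of_mem _ hx]
        by_cases hxs : ∑ i, x i = s
        · rw [hxs]
        · rw [Pi.single_eq_of_ne hxs, mul_zero, mul_zero]
      · rw [hψ, sumState_apply_of_notMem _ hx, mul_zero, mul_zero]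
    have h1 := hz ψ hmem ψ hmem
    rw [hE, inner_smul_right] at h1
    refine (mul_right_cancel₀ ?_ h1).symm
    rw [inner_self_ne_zero]
    intro h0
    have h2 := congrArg (fun φ : StateSpace F n => φ fun _ => s / n) h0
    simp only [hψ, sumState_apply_of_mem _ (const_mem_dualCode_evenLikeSubcode (D := D) (s / n))]
      at h2
    simp [mul_div_cancel₀ _ hn] at h2
  obtain ⟨t, ht⟩ := exists_traceChar_mul_ne_one hs
  refine ht ?_
  have h1 := (key (n * t)).symm.trans (key 0)
  rwa [mul_div_cancel_left₀ _ hn, zero_div, mul_zero, AddChar.map_zero_eq_one] at h1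

/-- The minimum distance of the CSS code is the least weight of an odd-like word of `D`, provided
that the odd-like words of `C^⊥` are no lighter. -/
theorem isStabilizerCodeWithParams_cssCode [DecidableEq F] (hn : (n : F) ≠ 0) (hD : 1 ∈ D) {d : ℕ}
    (hmin : ∀ b ∈ D, ∑ i, b i ≠ 0 → d ≤ hammingNorm b)
    (hdual : ∀ a ∈ dualCode (evenLikeSubcode D), ∑ i, a i ≠ 0 → d ≤ hammingNorm a)
    {b : Fin n → F} (hb : b ∈ D) (hs : ∑ i, b i ≠ 0) (hd : hammingNorm b = d) :
    IsStabilizerCodeWithParams (cssCode (evenLikeSubcode D) D) 1 d := by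
  refine ⟨isStabilizerCode_cssCode hn hD, by rw [finrank_cssCode hn hD, pow_one],
    fun c a b' hw => ?_, 0, 0, b, by rw [symplecticWeight_zero_left, hd],
    not_detects_opZ hn hD hb hs⟩
  by_cases ha : a ∈ dualCode (evenLikeSubcode D)
  swap
  · exact detects_of_notMem_dualCode c b' ha
  by_cases hb' : b' ∈ D
  swap
  · exact detects_of_notMem c a hb'
  refine detects_of_mem c (mem_dualCode_of_sum_eq_zero hn hD ha ?_) ⟨hb', ?_⟩
  · by_contra h
    exact absurd ((hdual a ha h).trans (hammingNorm_left_le a b')) hw.not_ge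
  · by_contra h
    exact absurd ((hmin b' hb' h).trans (hammingNorm_right_le a b')) hw.not_ge

end CSS

/-! ### Odd-like weights of duadic codes -/

section Duadic

theorem hammingNorm_comp_equiv {F ι : Type*} [Field F] [DecidableEq F] [Fintype ι]
    (e : ι ≃ ι) (c : ι → F) : hammingNorm (c ∘ e) = hammingNorm c :=
  Finset.card_equiv e fun l => by simp

theorem IsSplitting.ne_zero_iff {q n : ℕ} {S₀ S₁ : Set (ZMod n)}
    {a : (ZMod n)ˣ} (hS : IsSplitting q n S₀ S₁ a) {j : ZMod n} : j ≠ 0 ↔ j ∈ S₀ ∨ j ∈ S₁ := by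
  rw [← Set.mem_union, hS.union]
  rfl

variable {F : Type*} [Field F] [DecidableEq F] {n : ℕ} [NeZero n]

/-- The support of a word, as a set of residues. -/
def extendSupport (c : Fin n → F) : Finset (ZMod n) :=
  {l | c ((ZMod.finEquiv n).symm l) ≠ 0}

theorem mem_extendSupport {c : Fin n → F} {l : ZMod n} :
    l ∈ extendSupport c ↔ extend c l ≠ 0 := by
  simp [extendSupport, extend]

theorem card_extendSupport (c : Fin n → F) : (extendSupport c).card = hammingNorm c :=
  Finset.card_equiv (ZMod.finEquiv n).symm.toEquiv fun l => by simp [extendSupport]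

variable {q : ℕ} {S₀ S₁ : Set (ZMod n)} {a : (ZMod n)ˣ} {α : AlgebraicClosure F}

/-- The product of an odd-like word `c` of `D₀` with its image under the multiplier `a`, which lies
in `D₁`, is a nonzero multiple of the all-ones word. -/
theorem IsSplitting.exists_add_eq (hS : IsSplitting q n S₀ S₁ a) (hα : IsPrimitiveRoot α n)
    {c : Fin n → F} (hc : c ∈ cyclicCode α S₀) (hs : ∑ i, c i ≠ 0) (k : ZMod n) :
    ∃ l ∈ extendSupport c, ∃ m ∈ extendSupport c, l + ↑a⁻¹ * m = k := by
  have hs' : ∑ i, (c ∘ multiplier a) i ≠ 0 := by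
    simpa only [Function.comp_apply, Equiv.sum_comp (multiplier a) c] using hs
  have hc0 := (mem_cyclicCode_iff hα).1 hc
  obtain ⟨l, m, hl, hm, hlm⟩ := exists_add_eq_of_fourier_mul_eq_zero (rootChar_isPrimitive hα)
    (f := extend c) (g := extend (c ∘ multiplier a)) (fun j hj => by
      rcases hS.ne_zero_iff.1 hj with h | h
      · rw [hc0 j h, zero_mul]
      · rw [← hS.image₀] at h
        obtain ⟨i, hi, rfl⟩ := h
        rw [extend_comp_multiplier, fourier_comp_unit_mul]
        dsimp only
        rw [Units.inv_mul_cancel_left, hc0 i hi, mul_zero])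
    (sum_extend_ne_zero hs) (sum_extend_ne_zero hs') k
  rw [extend_comp_multiplier] at hm
  exact ⟨l, mem_extendSupport.2 hl, _, mem_extendSupport.2 hm, by
    rw [Units.inv_mul_cancel_left, hlm]⟩

/-- The square root bound. -/
theorem IsSplitting.le_hammingNorm_sq (hS : IsSplitting q n S₀ S₁ a) (hα : IsPrimitiveRoot α n)
    {c : Fin n → F} (hc : c ∈ cyclicCode α S₀) (hs : ∑ i, c i ≠ 0) :
    n ≤ hammingNorm c ^ 2 := by
  have hsub : (Finset.univ : Finset (ZMod n)) ⊆
      (extendSupport c ×ˢ extendSupport c).image fun p => p.1 + ↑a⁻¹ * p.2 := by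
    intro k _
    obtain ⟨l, hl, m, hm, hlm⟩ := hS.exists_add_eq hα hc hs k
    exact Finset.mem_image.2 ⟨(l, m), Finset.mk_mem_product hl hm, hlm⟩
  have h := (Finset.card_le_card hsub).trans Finset.card_image_le
  rwa [Finset.card_univ, ZMod.card, Finset.card_product, card_extendSupport, ← sq] at h

/-- For the multiplier `-1` every residue is a difference of two elements of the support, and all
the diagonal pairs give the same residue `0`. -/
theorem IsSplitting.le_hammingNorm_sq_sub (hS : IsSplitting q n S₀ S₁ (-1))
    (hα : IsPrimitiveRoot α n) {c : Fin n → F} (hc : c ∈ cyclicCode α S₀) (hs : ∑ i, c i ≠ 0) :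
    (n : ℤ) ≤ (hammingNorm c : ℤ) ^ 2 - (hammingNorm c : ℤ) + 1 := by
  have hsub : (Finset.univ : Finset (ZMod n)) ⊆
      insert 0 ((extendSupport c).offDiag.image fun p => p.1 - p.2) := by
    intro k _
    obtain ⟨l, hl, m, hm, hlm⟩ := hS.exists_add_eq hα hc hs k
    have hlm' : l - m = k := by simpa [← sub_eq_add_neg] using hlm
    rw [Finset.mem_insert, Finset.mem_image]
    by_cases h : l = m
    · exact Or.inl (by rw [← hlm', h, sub_self])
    · exact Or.inr ⟨(l, m), Finset.mem_offDiag.2 ⟨hl, hm, h⟩, hlm'⟩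
  have h := (Finset.card_le_card hsub).trans
    ((Finset.card_insert_le _ _).trans (Nat.add_le_add_right Finset.card_image_le 1))
  rw [Finset.card_univ, ZMod.card, Finset.offDiag_card, card_extendSupport] at h
  zify [Nat.le_mul_self (hammingNorm c)] at h
  linarith

variable [Fintype F]

/-- The dual of the even-like code of `S₀` lies in the odd-like code of `-S₁`, which the multiplier
`-a` carries onto the odd-like code of `S₀`, without changing weights or coordinate sums. -/
theorem IsSplitting.exists_mem_cyclicCode_of_mem_dualCode
    (hS : IsSplitting (Fintype.card F) n S₀ S₁ a) (hα : IsPrimitiveRoot α n) (hn : (n : F) ≠ 0)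
    (hcop : Nat.Coprime (Fintype.card F) n) {x : Fin n → F}
    (hx : x ∈ dualCode (evenLikeSubcode (cyclicCode α S₀))) :
    ∃ c ∈ cyclicCode α S₀, ∑ i, c i = ∑ i, x i ∧ hammingNorm c = hammingNorm x := by
  have hnK : (n : AlgebraicClosure F) ≠ 0 := by
    rw [← map_natCast (algebraMap F (AlgebraicClosure F))]
    exact (_root_.map_ne_zero _).2 hn
  refine ⟨x ∘ multiplier (-a)⁻¹, (mem_cyclicCode_iff hα).2 fun j hj => ?_,
    Equiv.sum_comp (multiplier (-a)⁻¹) x, hammingNorm_comp_equiv _ x⟩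
  rw [extend_comp_multiplier, fourier_comp_unit_mul, inv_inv, Units.val_neg, neg_mul]
  exact fourier_neg_eq_zero_of_mem_dualCode hα hnK hcop hS.coset₁ hS.disjoint
    (fun h => hS.ne_zero_iff.2 (Or.inr h) rfl) hx (hS.image₀ ▸ Set.mem_image_of_mem _ hj)

/-- The minimum distance of the quantum duadic code of a splitting is the weight of an odd-like word
of `D₀`. -/
theorem IsSplitting.exists_isStabilizerCodeWithParams
    (hS : IsSplitting (Fintype.card F) n S₀ S₁ a) (hα : IsPrimitiveRoot α n) (hn : (n : F) ≠ 0)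
    (hcop : Nat.Coprime (Fintype.card F) n) :
    ∃ c ∈ cyclicCode α S₀, ∑ i, c i ≠ 0 ∧
      IsStabilizerCodeWithParams
        (cssCode (evenLikeSubcode (cyclicCode α S₀)) (cyclicCode α S₀)) 1 (hammingNorm c) := by
  have h1 : (1 : Fin n → F) ∈ cyclicCode α S₀ :=
    one_mem_cyclicCode hα fun h => hS.ne_zero_iff.2 (Or.inl h) rfl
  obtain ⟨c, ⟨hc, hs⟩, hmin⟩ := exists_minimalFor_of_wellFoundedLT
    (fun c : Fin n → F => c ∈ cyclicCode α S₀ ∧ ∑ i, c i ≠ 0) hammingNorm ⟨1, h1, by simpa using hn⟩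
  have hmin' : ∀ b ∈ cyclicCode α S₀, ∑ i, b i ≠ 0 → hammingNorm c ≤ hammingNorm b :=
    fun b hb hbs => (le_total (hammingNorm c) (hammingNorm b)).elim id (hmin ⟨hb, hbs⟩)
  refine ⟨c, hc, hs, isStabilizerCodeWithParams_cssCode hn h1 hmin' (fun x hx hxs => ?_) hc hs rfl⟩
  obtain ⟨b, hb, hbs, hbw⟩ := hS.exists_mem_cyclicCode_of_mem_dualCode hα hn hcop hx
  exact hbw ▸ hmin' b hb (hbs ▸ hxs)

end Duadic

end QDuadic

end

theorem mainTheorem5 {F : Type*} [Field F] [Fintype F] (q n : ℕ) (hq : Fintype.card F = q)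
    (hn : Odd n) (hcop : Nat.Coprime q n) (hsq : IsSquare (q : ZMod n)) :
    (∃ (Q : Submodule ℂ (QDuadic.StateSpace F n)) (d : ℕ),
      QDuadic.IsQuantumDuadicCode Q ∧ QDuadic.IsStabilizerCodeWithParams Q 1 d ∧ n ≤ d ^ 2) ∧
    (Odd (orderOf (q : ZMod n)) →
      ∃ (Q : Submodule ℂ (QDuadic.StateSpace F n)) (d : ℕ),
        QDuadic.IsQuantumDuadicCode Q ∧ QDuadic.IsStabilizerCodeWithParams Q 1 d ∧
          (n : ℤ) ≤ (d : ℤ) ^ 2 - (d : ℤ) + 1) := by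
  subst hq
  classical
  have : NeZero n := ⟨by rintro rfl; simp at hn⟩
  have hnF : (n : F) ≠ 0 := by
    intro h
    obtain ⟨m, hp, hm⟩ := FiniteField.card F (ringChar F)
    have hdvd : ringChar F ∣ n := (ringChar.spec F n).1 h
    have hdvd' : ringChar F ∣ Fintype.card F := hm ▸ dvd_pow_self _ m.ne_zero
    exact hp.one_lt.ne' (Nat.eq_one_of_dvd_coprimes hcop hdvd' hdvd)
  have : NeZero (n : AlgebraicClosure F) := ⟨by
    rw [← map_natCast (algebraMap F (AlgebraicClosure F))]
    exact (_root_.map_ne_zero _).2 hnF⟩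
  obtain ⟨α, hα⟩ := HasEnoughRootsOfUnity.exists_primitiveRoot (AlgebraicClosure F) n
  refine ⟨?_, fun hord => ?_⟩
  · obtain ⟨S₀, S₁, a, hS⟩ := QDuadic.exists_isSplitting hn hcop hsq
    obtain ⟨c, hc, hs, hQ⟩ := hS.exists_isStabilizerCodeWithParams hα hnF hcop
    exact ⟨_, _, ⟨S₀, S₁, a, α, hS, hα, rfl⟩, hQ, hS.le_hammingNorm_sq hα hc hs⟩
  · obtain ⟨S₀, S₁, hS⟩ := QDuadic.exists_isSplitting_neg_one hn hcop hord
    obtain ⟨c, hc, hs, hQ⟩ := hS.exists_isStabilizerCodeWithParams hα hnF hcop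
    exact ⟨_, _, ⟨S₀, S₁, -1, α, hS, hα, rfl⟩, hQ, hS.le_hammingNorm_sq_sub hα hc hs⟩
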